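/- For integers $v,k,g,\lambda$, an $egr(v,k,g,\lambda)$-graph is a finite simple $k$-regular graph on $v$ vertices of girth $g$ (the length of a shortest cycle) in which every edge is contained in exactly $\lambda$ cycles of length $g$, where cycles are counted as subgraphs. For every $v$, an $egr(v,3,8,14)$-graph does not exist. That is, there is no finite cubic graph (connected or not) of girth $8$ in which every edge lies on exactly $14$ cycles of length $8$. -/

import Mathlib

namespace SimpleGraph

/-- The cycles of length `n` in `G` as subgraphs of `G`. A cycle is identified with the subgraph it
traces out, so choices of starting vertex and direction are not counted separately. -/
def cyclesOfLength {V : Type*} (G : SimpleGraph V) (n : ℕ) : Set G.Subgraph :=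
  {C | ∃ (u : V) (p : G.Walk u u), p.IsCycle ∧ p.length = n ∧ p.toSubgraph = C}

/-- `G` is an edge-girth-regular `(v, k, g, l)`-graph: it has `v` vertices, is `k`-regular, has
girth `g`, and every edge lies on exactly `l` cycles of length `g`. -/
structure IsEdgeGirthRegular {V : Type*} [Fintype V] (G : SimpleGraph V) [G.LocallyFinite]
    (v k g l : ℕ) : Prop where
  card_eq : Fintype.card V = v
  regular : G.IsRegularOfDegree k
  egirth_eq : G.egirth = g
  cycles_eq : ∀ e ∈ G.edgeSet, {C ∈ G.cyclesOfLength g | e ∈ C.edgeSet}.ncard = l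

end SimpleGraph

namespace SimpleGraph

variable {V : Type*} {G : SimpleGraph V}

/-! Fix an edge `u v`. Girth eight makes the two depth-three trees at its ends disjoint, with 8
leaves each, and octagons through `u v` correspond to edges between the two leaf sets. Of the 16
arcs going on from the leaves at `u`, 14 reach leaves at `v`, so two stubs remain on each side.
Comparing neighbouring edges shows that the stubs at `u` share their end, the apex
(`HasTwoStubs.exists_stubs_eq`), and that the two apices are adjacent (`HasTwoStubs.apex_adj_apex`).
The component of `u v` therefore has 15 + 15 + 2 = 32 vertices.

The apex on the side of `v` does not depend on the neighbour `v` of `u` (`HasTwoStubs.apex_congr`),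
so it is an antipode of `u`; the antipodal map is an involutive automorphism. Let `A` be the
adjacency matrix and `P` the permutation matrix of this map, both restricted to the component. Then
`A P = P A` and `P ^ 2 = 1`, so `(A P) ^ 5 = A ^ 5 P`. No vertex is adjacent to its antipode, so `A
P` has trace 0; six walks of length five join a vertex to its antipode, so `A ^ 5 P` has trace 32 *
6 = 192. Modulo 5 the trace of a fifth power is the fifth power of the trace, but 5 does not divide
192. -/

/-- The end points of the non-backtracking walks with `n` steps that start at `u` and whose first
step does not lead to `v`. -/
def arcSphere (G : SimpleGraph V) : ℕ → V → V → Set V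
  | 0, u, _ => {u}
  | n + 1, u, v => {x | ∃ a, G.Adj u a ∧ a ≠ v ∧ x ∈ arcSphere G n a u}

/-- The last arcs of the non-backtracking walks with `n + 1` steps that start at `u` and whose
first step does not lead to `v`. -/
def arcEdges (G : SimpleGraph V) : ℕ → V → V → Set (V × V)
  | 0, u, v => {e | e.1 = u ∧ G.Adj u e.2 ∧ e.2 ≠ v}
  | n + 1, u, v => {e | ∃ a, G.Adj u a ∧ a ≠ v ∧ e ∈ arcEdges G n a u}

/-- The arcs leaving the leaves of the tree of depth three at `u` that do not lead to leaves of the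
tree of depth three at `v`. -/
def stubs (G : SimpleGraph V) (u v : V) : Set (V × V) :=
  {e ∈ G.arcEdges 3 u v | e.2 ∉ G.arcSphere 3 v u}

/-- Every vertex has exactly three neighbours, in a form convenient for rewriting. -/
def IsCubic (G : SimpleGraph V) : Prop :=
  ∀ ⦃u v⦄, G.Adj u v → ∃ a b, a ≠ b ∧ a ≠ v ∧ b ≠ v ∧ ∀ w, G.Adj u w ↔ w = v ∨ w = a ∨ w = b

/-- All cycles have length at least eight. -/
def GirthGEEight (G : SimpleGraph V) : Prop :=
  ∀ ⦃w⦄ (c : G.Walk w w), c.IsCycle → 8 ≤ c.length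

/-! ### Moves in non-backtracking trees -/

theorem mem_arcSphere_succ {n : ℕ} {u v x : V} :
    x ∈ G.arcSphere (n + 1) u v ↔ ∃ a, G.Adj u a ∧ a ≠ v ∧ x ∈ G.arcSphere n a u := Iff.rfl

theorem mem_arcEdges_succ {n : ℕ} {u v : V} {e : V × V} :
    e ∈ G.arcEdges (n + 1) u v ↔ ∃ a, G.Adj u a ∧ a ≠ v ∧ e ∈ G.arcEdges n a u := Iff.rfl

theorem arcEdges_spec {n : ℕ} {u v : V} {e : V × V} (h : e ∈ G.arcEdges n u v) :
    e.1 ∈ G.arcSphere n u v ∧ e.2 ∈ G.arcSphere (n + 1) u v ∧ G.Adj e.1 e.2 := by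
  induction n generalizing u v with
  | zero =>
    obtain ⟨h1, h2, h3⟩ := h
    exact ⟨h1, ⟨e.2, h2, h3, rfl⟩, h1 ▸ h2⟩
  | succ n ih =>
    obtain ⟨a, ha, hav, h⟩ := h
    obtain ⟨h1, h2, h3⟩ := ih h
    exact ⟨⟨a, ha, hav, h1⟩, ⟨a, ha, hav, h2⟩, h3⟩

theorem arcSphere_step {n : ℕ} {u v x y : V} (hx : x ∈ G.arcSphere n u v) (hxy : G.Adj x y) :
    (x, y) ∈ G.arcEdges n u v ∨ (n = 0 ∧ y = v) ∨ ∃ m, n = m + 1 ∧ y ∈ G.arcSphere m u v := by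
  induction n generalizing u v with
  | zero =>
    obtain rfl : x = u := hx
    by_cases hy : y = v
    · exact Or.inr (Or.inl ⟨rfl, hy⟩)
    · exact Or.inl ⟨rfl, hxy, hy⟩
  | succ n ih =>
    obtain ⟨a, ha, hav, hx⟩ := hx
    obtain h | ⟨rfl, rfl⟩ | ⟨m, rfl, h⟩ := ih hx
    · exact Or.inl ⟨a, ha, hav, h⟩
    · exact Or.inr (Or.inr ⟨0, rfl, rfl⟩)
    · exact Or.inr (Or.inr ⟨m + 1, rfl, a, ha, hav, h⟩)

theorem arcSphere_succ_step {n : ℕ} {u v x y : V} (hx : x ∈ G.arcSphere (n + 1) u v)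
    (hxy : G.Adj x y) : (x, y) ∈ G.arcEdges (n + 1) u v ∨ y ∈ G.arcSphere n u v := by
  obtain h | ⟨h, -⟩ | ⟨m, h, h'⟩ := arcSphere_step hx hxy
  · exact Or.inl h
  · omega
  · obtain rfl : m = n := by omega
    exact Or.inr h'

/-! ### Consequences of the girth -/

theorem GirthGEEight.path_eq (hg : G.GirthGEEight) {u v : V} {p q : G.Walk u v} (hp : p.IsPath)
    (hq : q.IsPath) (hpq : p.length + q.length < 8) : p = q := by
  classical
  -- A cycle in the union of the two paths would have fewer than eight edges, so the union is a
  -- forest, where paths are unique.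
  let H : SimpleGraph V := fromEdgeSet {e | e ∈ p.edges ++ q.edges}
  have key : ∀ e, e ∈ p.edges ++ q.edges → e ∈ G.edgeSet → e ∈ H.edgeSet := by
    intro e he he'
    simp only [H, edgeSet_fromEdgeSet]
    exact ⟨he, G.not_isDiag_of_mem_edgeSet he'⟩
  have hH : H.IsAcyclic := by
    intro w c hc
    have hsub : ∀ e ∈ c.edges, e ∈ p.edges ++ q.edges := by
      intro e he
      have := c.edges_subset_edgeSet he
      simp only [H, edgeSet_fromEdgeSet] at this
      exact this.1
    have hG : ∀ e ∈ c.edges, e ∈ G.edgeSet := by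
      intro e he
      obtain h | h := List.mem_append.1 (hsub e he)
      · exact p.edges_subset_edgeSet h
      · exact q.edges_subset_edgeSet h
    have h8 := hg _ (hc.transfer hG)
    rw [Walk.length_transfer] at h8
    have := (hc.edges_nodup.subperm hsub).length_le
    simp only [List.length_append, Walk.length_edges] at this
    omega
  have hp' : ∀ e ∈ p.edges, e ∈ H.edgeSet := fun e he =>
    key e (List.mem_append_left _ he) (p.edges_subset_edgeSet he)
  have hq' : ∀ e ∈ q.edges, e ∈ H.edgeSet := fun e he =>
    key e (List.mem_append_right _ he) (q.edges_subset_edgeSet he)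
  have h1 := (hH.subsingleton_path u v).elim ⟨p.transfer H hp', hp.transfer hp'⟩
    ⟨q.transfer H hq', hq.transfer hq'⟩
  have h2 : p.transfer H hp' = q.transfer H hq' := congrArg Subtype.val h1
  have h3 := congrArg Walk.support h2
  rw [Walk.support_transfer, Walk.support_transfer] at h3
  exact Walk.ext_support h3

/-- A return to `v` would close a cycle with at most seven edges. -/
theorem GirthGEEight.exists_path (hg : G.GirthGEEight) {n : ℕ} (hn : n ≤ 6) {u v x : V}
    (huv : G.Adj u v) (hx : x ∈ G.arcSphere n u v) :
    ∃ p : G.Walk u x, p.IsPath ∧ p.length = n ∧ v ∉ p.support := by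
  classical
  induction n generalizing u v with
  | zero =>
    obtain rfl : x = u := hx
    exact ⟨Walk.nil, by simp, rfl, by simpa using huv.ne'⟩
  | succ n ih =>
    obtain ⟨a, ha, hav, hx⟩ := hx
    obtain ⟨q, hq, hql, hqu⟩ := ih (by omega) ha.symm hx
    refine ⟨Walk.cons ha q, (Walk.cons_isPath_iff _ _).2 ⟨hq, hqu⟩, by simp [hql], ?_⟩
    rw [Walk.support_cons, List.mem_cons, not_or]
    refine ⟨huv.ne', fun hv => ?_⟩
    have hu' : u ∉ (q.takeUntil v hv).support := fun h =>
      hqu (q.support_takeUntil_subset_support hv h)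
    have hc : (Walk.cons huv.symm (Walk.cons ha (q.takeUntil v hv))).IsCycle := by
      refine (Walk.cons_isCycle_iff _ _).2 ⟨(Walk.cons_isPath_iff _ _).2 ⟨hq.takeUntil hv, hu'⟩, ?_⟩
      rw [Walk.edges_cons, List.mem_cons, not_or]
      constructor
      · intro h
        obtain ⟨h, -⟩ | ⟨h, -⟩ := Sym2.eq_iff.1 h
        · exact huv.ne' h
        · exact hav h.symm
      · exact fun h => hu' (Walk.snd_mem_support_of_mem_edges _ h)
    have h8 := hg _ hc
    have := q.length_takeUntil_le_length hv
    simp only [Walk.length_cons] at h8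
    omega

/-- The paths `v u … x` and `v … x` have total length at most seven, hence agree, yet only the first
visits `u`. -/
theorem GirthGEEight.arcSphere_disj (hg : G.GirthGEEight) {i j : ℕ} (hij : i + j ≤ 6) {u v x : V}
    (huv : G.Adj u v) (hx : x ∈ G.arcSphere i u v) (hx' : x ∈ G.arcSphere j v u) : False := by
  obtain ⟨p, hp, hpl, hpv⟩ := hg.exists_path (by omega) huv hx
  obtain ⟨q, hq, hql, hqu⟩ := hg.exists_path (by omega) huv.symm hx'
  have := hg.path_eq ((Walk.cons_isPath_iff huv.symm p).2 ⟨hp, hpv⟩) hq (by simp; omega)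
  apply hqu
  rw [← this]
  simp

/-- Cancel common initial steps; where the two walks diverge they lie on opposite sides of an edge,
and `arcSphere_disj` applies. -/
theorem GirthGEEight.arcSphere_disj_of_lt (hg : G.GirthGEEight) {i j : ℕ} (hij : i + j ≤ 7)
    (hlt : i < j) {u v x : V} (hx : x ∈ G.arcSphere i u v) (hx' : x ∈ G.arcSphere j u v) :
    False := by
  induction i generalizing j u v with
  | zero =>
    obtain ⟨j, rfl⟩ : ∃ k, j = k + 1 := ⟨j - 1, by omega⟩
    obtain rfl : x = u := hx
    obtain ⟨a, ha, hav, hx'⟩ := hx'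
    exact hg.arcSphere_disj (i := j) (j := 0) (by omega) ha.symm hx' rfl
  | succ i ih =>
    obtain ⟨j, rfl⟩ : ∃ k, j = k + 1 := ⟨j - 1, by omega⟩
    obtain ⟨a, ha, hav, hx⟩ := hx
    obtain ⟨b, hb, hbv, hx'⟩ := hx'
    by_cases hab : a = b
    · subst hab
      exact ih (by omega) (by omega) hx hx'
    · exact hg.arcSphere_disj (i := i) (j := j + 1) (by omega) ha.symm hx
        ⟨b, hb, fun h => hab h.symm, hx'⟩

theorem GirthGEEight.branch_eq (hg : G.GirthGEEight) {i j : ℕ} (hij : i + j ≤ 5) {u a b x : V}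
    (ha : G.Adj u a) (hb : G.Adj u b) (hx : x ∈ G.arcSphere i a u) (hx' : x ∈ G.arcSphere j b u) :
    a = b := by
  by_contra hab
  exact hg.arcSphere_disj (i := i) (j := j + 1) (by omega) ha.symm hx
        ⟨b, hb, fun h => hab h.symm, hx'⟩

theorem GirthGEEight.arcEdges_inj (hg : G.GirthGEEight) {n : ℕ} (hn : n ≤ 2) {u v x x' w : V}
    (h : (x, w) ∈ G.arcEdges n u v) (h' : (x', w) ∈ G.arcEdges n u v) : x = x' := by
  induction n generalizing u v with
  | zero => exact h.1.trans h'.1.symm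
  | succ n ih =>
    obtain ⟨a, ha, hav, h⟩ := h
    obtain ⟨b, hb, hbv, h'⟩ := h'
    obtain rfl := hg.branch_eq (by omega) ha hb (arcEdges_spec h).2.1 (arcEdges_spec h').2.1
    exact ih (by omega) h h'

/-- An arc that leaves a leaf and does not lead to the parent. -/
theorem mem_stubs_of_adj {u v x y : V} (hx : x ∈ G.arcSphere 3 u v) (hxy : G.Adj x y)
    (h2 : y ∉ G.arcSphere 2 u v) (h3 : y ∉ G.arcSphere 3 v u) : (x, y) ∈ G.stubs u v :=
  ⟨(arcSphere_succ_step hx hxy).resolve_right h2, h3⟩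

/-! ### Sizes of spheres and arc sets -/

theorem IsCubic.card_arcSphere (hc : G.IsCubic) (hg : G.GirthGEEight) {n : ℕ} (hn : n ≤ 3)
    {u v : V} (huv : G.Adj u v) :
    (G.arcSphere n u v).Finite ∧ (G.arcSphere n u v).ncard = 2 ^ n := by
  induction n generalizing u v with
  | zero => exact ⟨Set.finite_singleton u, Set.ncard_singleton u⟩
  | succ n ih =>
    obtain ⟨a, b, hab, hav, hbv, h⟩ := hc huv
    have ha : G.Adj u a := (h a).2 (by simp)
    have hb : G.Adj u b := (h b).2 (by simp)
    have heq : G.arcSphere (n + 1) u v = G.arcSphere n a u ∪ G.arcSphere n b u := by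
      ext x
      simp only [mem_arcSphere_succ, h, Set.mem_union]
      constructor
      · rintro ⟨c, rfl | rfl | rfl, hcv, hx⟩
        · exact absurd rfl hcv
        · exact Or.inl hx
        · exact Or.inr hx
      · rintro (hx | hx)
        · exact ⟨a, by simp, hav, hx⟩
        · exact ⟨b, by simp, hbv, hx⟩
    obtain ⟨fa, ca⟩ := ih (by omega) ha.symm
    obtain ⟨fb, cb⟩ := ih (by omega) hb.symm
    rw [heq, Set.ncard_union_eq (Set.disjoint_left.2 fun x hx hx' =>
      hab (hg.branch_eq (by omega) ha hb hx hx')) fa fb, ca, cb]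
    exact ⟨fa.union fb, by ring⟩

theorem IsCubic.card_arcEdges (hc : G.IsCubic) (hg : G.GirthGEEight) {n : ℕ} (hn : n ≤ 3)
    {u v : V} (huv : G.Adj u v) :
    (G.arcEdges n u v).Finite ∧ (G.arcEdges n u v).ncard = 2 ^ (n + 1) := by
  induction n generalizing u v with
  | zero =>
    obtain ⟨a, b, hab, hav, hbv, h⟩ := hc huv
    have heq : G.arcEdges 0 u v = {(u, a), (u, b)} := by
      ext ⟨x, y⟩
      simp only [arcEdges, Set.mem_ofPred_eq, h, Set.mem_insert_iff, Set.mem_singleton_iff,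
        Prod.mk.injEq]
      constructor
      · rintro ⟨rfl, rfl | rfl | rfl, hy⟩
        · exact absurd rfl hy
        · simp
        · simp
      · rintro (⟨rfl, rfl⟩ | ⟨rfl, rfl⟩) <;> simp [hav, hbv]
    rw [heq]
    exact ⟨by simp, Set.ncard_pair (by simp [hab])⟩
  | succ n ih =>
    obtain ⟨a, b, hab, hav, hbv, h⟩ := hc huv
    have ha : G.Adj u a := (h a).2 (by simp)
    have hb : G.Adj u b := (h b).2 (by simp)
    have heq : G.arcEdges (n + 1) u v = G.arcEdges n a u ∪ G.arcEdges n b u := by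
      ext x
      simp only [mem_arcEdges_succ, h, Set.mem_union]
      constructor
      · rintro ⟨c, rfl | rfl | rfl, hcv, hx⟩
        · exact absurd rfl hcv
        · exact Or.inl hx
        · exact Or.inr hx
      · rintro (hx | hx)
        · exact ⟨a, by simp, hav, hx⟩
        · exact ⟨b, by simp, hbv, hx⟩
    obtain ⟨fa, ca⟩ := ih (by omega) ha.symm
    obtain ⟨fb, cb⟩ := ih (by omega) hb.symm
    rw [heq, Set.ncard_union_eq (Set.disjoint_left.2 fun x hx hx' =>
      hab (hg.branch_eq (by omega) ha hb (arcEdges_spec hx).1 (arcEdges_spec hx').1)) fa fb, ca, cb]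
    exact ⟨fa.union fb, by ring⟩

/-! ### Octagons through an edge -/

/-- The octagon `u a b x y d c v`, started at `u`, as a closed walk. -/
def octagon {u a b x y d c v : V} (h₁ : G.Adj u a) (h₂ : G.Adj a b) (h₃ : G.Adj b x)
    (h₄ : G.Adj x y) (h₅ : G.Adj y d) (h₆ : G.Adj d c) (h₇ : G.Adj c v) (h₈ : G.Adj v u) :
    G.Walk u u :=
  .cons h₁ (.cons h₂ (.cons h₃ (.cons h₄ (.cons h₅ (.cons h₆ (.cons h₇ (.cons h₈ .nil)))))))

/-- The adjacent pairs of leaves of the two trees of depth three at an edge. -/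
def leafEdges (G : SimpleGraph V) (u v : V) : Set (V × V) :=
  {e | e.1 ∈ G.arcSphere 3 u v ∧ e.2 ∈ G.arcSphere 3 v u ∧ G.Adj e.1 e.2}

/-- `C` is the octagon through the edge `u v` with the opposite edge `e`. -/
def IsOctagon (G : SimpleGraph V) (u v : V) (e : V × V) (C : G.Subgraph) : Prop :=
  ∃ (a b d c : V) (h₁ : G.Adj u a) (h₂ : G.Adj a b) (h₃ : G.Adj b e.1) (h₄ : G.Adj e.1 e.2)
    (h₅ : G.Adj e.2 d) (h₆ : G.Adj d c) (h₇ : G.Adj c v) (h₈ : G.Adj v u),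
    a ≠ v ∧ b ≠ u ∧ e.1 ≠ a ∧ c ≠ u ∧ d ≠ v ∧ e.2 ≠ c ∧
    (octagon h₁ h₂ h₃ h₄ h₅ h₆ h₇ h₈).toSubgraph = C

theorem mem_arcEdges_one {u v a b : V} (h₁ : G.Adj u a) (h₂ : G.Adj a b) (hav : a ≠ v)
    (hbu : b ≠ u) : (a, b) ∈ G.arcEdges 1 u v :=
  ⟨a, h₁, hav, rfl, h₂, hbu⟩

theorem mem_arcEdges_two {u v a b x : V} (h₁ : G.Adj u a) (h₂ : G.Adj a b) (h₃ : G.Adj b x)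
    (hav : a ≠ v) (hbu : b ≠ u) (hxa : x ≠ a) : (b, x) ∈ G.arcEdges 2 u v :=
  ⟨a, h₁, hav, mem_arcEdges_one h₂ h₃ hbu hxa⟩

theorem mem_arcEdges_three {u v a b x y : V} (h₁ : G.Adj u a) (h₂ : G.Adj a b) (h₃ : G.Adj b x)
    (h₄ : G.Adj x y) (hav : a ≠ v) (hbu : b ≠ u) (hxa : x ≠ a) (hyb : y ≠ b) :
    (x, y) ∈ G.arcEdges 3 u v :=
  ⟨a, h₁, hav, mem_arcEdges_two h₂ h₃ h₄ hbu hxa hyb⟩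

theorem exists_of_mem_arcSphere_three {u v x : V} (h : x ∈ G.arcSphere 3 u v) :
    ∃ a b, G.Adj u a ∧ G.Adj a b ∧ G.Adj b x ∧ a ≠ v ∧ b ≠ u ∧ x ≠ a := by
  obtain ⟨a, ha, hav, b, hb, hbu, c, hc, hca, rfl⟩ := h
  exact ⟨a, b, ha, hb, hc, hav, hbu, hca⟩

theorem GirthGEEight.eq_and_eq_of_path (hg : G.GirthGEEight) {u v a b a' b' x : V}
    (h₁ : G.Adj u a) (h₂ : G.Adj a b) (h₃ : G.Adj b x) (hav : a ≠ v) (hbu : b ≠ u) (hxa : x ≠ a)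
    (h₁' : G.Adj u a') (h₂' : G.Adj a' b') (h₃' : G.Adj b' x) (hav' : a' ≠ v) (hbu' : b' ≠ u)
    (hxa' : x ≠ a') : a = a' ∧ b = b' := by
  obtain rfl := hg.arcEdges_inj le_rfl (mem_arcEdges_two h₁ h₂ h₃ hav hbu hxa)
    (mem_arcEdges_two h₁' h₂' h₃' hav' hbu' hxa')
  exact ⟨hg.arcEdges_inj (by omega) (mem_arcEdges_one h₁ h₂ hav hbu)
    (mem_arcEdges_one h₁' h₂' hav' hbu'), rfl⟩

theorem IsOctagon.unique_right (hg : G.GirthGEEight) {u v : V} {e : V × V} {C C' : G.Subgraph}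
    (h : G.IsOctagon u v e C) (h' : G.IsOctagon u v e C') : C = C' := by
  obtain ⟨x, y⟩ := e
  obtain ⟨a, b, d, c, h₁, h₂, h₃, h₄, h₅, h₆, h₇, h₈, n₁, n₂, n₃, n₄, n₅, n₆, rfl⟩ := h
  obtain ⟨a', b', d', c', k₁, k₂, k₃, k₄, k₅, k₆, k₇, k₈, m₁, m₂, m₃, m₄, m₅, m₆, rfl⟩ := h'
  obtain ⟨rfl, rfl⟩ := hg.eq_and_eq_of_path h₁ h₂ h₃ n₁ n₂ n₃ k₁ k₂ k₃ m₁ m₂ m₃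
  obtain ⟨rfl, rfl⟩ := hg.eq_and_eq_of_path h₇.symm h₆.symm h₅.symm n₄ n₅ n₆ k₇.symm k₆.symm
    k₅.symm m₄ m₅ m₆
  rfl

theorem IsOctagon.mem_verts {u v : V} {e : V × V} {C : G.Subgraph} (h : G.IsOctagon u v e C) :
    e.1 ∈ C.verts ∧ e.2 ∈ C.verts := by
  obtain ⟨a, b, d, c, h₁, h₂, h₃, h₄, h₅, h₆, h₇, h₈, n₁, n₂, n₃, n₄, n₅, n₆, rfl⟩ := h
  simp [octagon]

/-- An octagon determines its opposite edge: its vertices lie one in each of the eight disjoint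
spheres, so it has one leaf on each side. -/
theorem IsOctagon.eq_of_mem_verts (hg : G.GirthGEEight) {u v : V} {e : V × V} {C : G.Subgraph}
    (h : G.IsOctagon u v e C) {x : V} (hx : x ∈ C.verts) :
    (x ∈ G.arcSphere 3 u v → x = e.1) ∧ (x ∈ G.arcSphere 3 v u → x = e.2) := by
  obtain ⟨a, b, d, c, h₁, h₂, h₃, h₄, h₅, h₆, h₇, h₈, n₁, n₂, n₃, n₄, n₅, n₆, rfl⟩ := h
  have e₁ := arcEdges_spec (mem_arcEdges_one (v := v) h₁ h₂ n₁ n₂)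
  have e₂ := arcEdges_spec (mem_arcEdges_two (v := v) h₁ h₂ h₃ n₁ n₂ n₃)
  have e₃ := arcEdges_spec (mem_arcEdges_one h₇.symm h₆.symm n₄ n₅)
  have e₄ := arcEdges_spec (mem_arcEdges_two h₇.symm h₆.symm h₅.symm n₄ n₅ n₆)
  have e₅ : u ∈ G.arcSphere 0 u v := rfl
  have e₆ : v ∈ G.arcSphere 0 v u := rfl
  have hs {i : ℕ} (hi : i < 3) {p q w : V} (h : x ∈ G.arcSphere i p q)
      (h' : x ∈ G.arcSphere 3 p q) : x = w := (hg.arcSphere_disj_of_lt (by omega) hi h h').elim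
  have ho {i : ℕ} (hi : i ≤ 3) {p q w : V} (hpq : G.Adj p q) (h : x ∈ G.arcSphere i p q)
      (h' : x ∈ G.arcSphere 3 q p) : x = w := (hg.arcSphere_disj (by omega) hpq h h').elim
  simp only [octagon, Walk.verts_toSubgraph, Walk.support_cons, Walk.support_nil, List.mem_cons,
    List.not_mem_nil, or_false, Set.mem_ofPred_eq] at hx
  obtain rfl | rfl | rfl | rfl | rfl | rfl | rfl | rfl | rfl := hx
  · exact ⟨hs (by omega) e₅, ho (by omega) h₈.symm e₅⟩
  · exact ⟨hs (by omega) e₁.1, ho (by omega) h₈.symm e₁.1⟩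
  · exact ⟨hs (by omega) e₂.1, ho (by omega) h₈.symm e₂.1⟩
  · exact ⟨fun _ => rfl, ho (by omega) h₈.symm e₂.2.1⟩
  · exact ⟨ho (by omega) h₈ e₄.2.1, fun _ => rfl⟩
  · exact ⟨ho (by omega) h₈ e₄.1, hs (by omega) e₄.1⟩
  · exact ⟨ho (by omega) h₈ e₃.1, hs (by omega) e₃.1⟩
  · exact ⟨ho (by omega) h₈ e₆, hs (by omega) e₆⟩
  · exact ⟨hs (by omega) e₅, ho (by omega) h₈.symm e₅⟩

theorem IsOctagon.mem_cycles (hg : G.GirthGEEight) {u v : V} {e : V × V} {C : G.Subgraph}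
    (h : G.IsOctagon u v e C) : C ∈ {C ∈ G.cyclesOfLength 8 | s(u, v) ∈ C.edgeSet} := by
  obtain ⟨x, y⟩ := e
  obtain ⟨a, b, d, c, h₁, h₂, h₃, h₄, h₅, h₆, h₇, h₈, n₁, n₂, n₃, n₄, n₅, n₆, rfl⟩ := h
  refine ⟨⟨u, _, ?_, rfl, rfl⟩, by simp [octagon, Sym2.eq_swap]⟩
  have e₁ := arcEdges_spec (mem_arcEdges_one (v := v) h₁ h₂ n₁ n₂)
  have e₂ := arcEdges_spec (mem_arcEdges_two (v := v) h₁ h₂ h₃ n₁ n₂ n₃)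
  have e₃ := arcEdges_spec (mem_arcEdges_one h₇.symm h₆.symm n₄ n₅)
  have e₄ := arcEdges_spec (mem_arcEdges_two h₇.symm h₆.symm h₅.symm n₄ n₅ n₆)
  have e₅ : u ∈ G.arcSphere 0 u v := rfl
  have e₆ : v ∈ G.arcSphere 0 v u := rfl
  have hs {i j : ℕ} (hij : i < j) (hj : j ≤ 3) {x y p q : V} (h : x ∈ G.arcSphere i p q)
      (h' : y ∈ G.arcSphere j p q) : x ≠ y := by
    rintro rfl
    exact hg.arcSphere_disj_of_lt (by omega) hij h h'
  have ho {i j : ℕ} (hi : i ≤ 3) (hj : j ≤ 3) {x y : V} (h : x ∈ G.arcSphere i u v)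
      (h' : y ∈ G.arcSphere j v u) : x ≠ y := by
    rintro rfl
    exact hg.arcSphere_disj (by omega) h₈.symm h h'
  have hua := h₁.ne
  have hub := hs (by omega) (by omega) e₅ e₂.1
  have hux := hs (by omega) (by omega) e₅ e₂.2.1
  have hab := h₂.ne
  have hax := n₃.symm
  have hbx := h₃.ne
  have hvc := h₇.ne
  have hvd := n₅
  have hvy := (hs (by omega) (by omega) e₆ e₄.2.1).symm
  have hdc := h₆.ne
  have hyc := n₆
  have hyd := h₅.ne
  have huy := ho (by omega) (by omega) e₅ e₄.2.1
  have hud := ho (by omega) (by omega) e₅ e₄.1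
  have huv := h₈.ne
  have hay := ho (by omega) (by omega) e₁.1 e₄.2.1
  have had := ho (by omega) (by omega) e₁.1 e₄.1
  have hac := ho (by omega) (by omega) e₁.1 e₃.1
  have hby := ho (by omega) (by omega) e₂.1 e₄.2.1
  have hbd := ho (by omega) (by omega) e₂.1 e₄.1
  have hbc := ho (by omega) (by omega) e₂.1 e₃.1
  have hbv := ho (by omega) (by omega) e₂.1 e₆
  have hxy := h₄.ne
  have hxd := ho (by omega) (by omega) e₂.2.1 e₄.1
  have hxc := ho (by omega) (by omega) e₂.2.1 e₃.1
  have hxv := ho (by omega) (by omega) e₂.2.1 e₆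
  simp [octagon, Walk.cons_isCycle_iff, Walk.cons_isPath_iff, hub.symm, hux.symm, huy.symm,
    hud.symm, hua.symm, n₄, huv, hab, hax, n₁, hay, had, hac, hbx, hby, hbd, hbc, hbv, hxy, hxd,
    hxc, hxv, hyd, hyc, hvy, hdc, hvd, hvc, hua, hub, hux, huy, hud]

theorem IsOctagon.of_isCycle {u v : V} {q : G.Walk u u} (hq : q.IsCycle) (hl : q.length = 8)
    (hv : q.penultimate = v) :
    ∃ e ∈ G.leafEdges u v, G.IsOctagon u v e q.toSubgraph := by
  cases q with
  | nil => simp at hl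
  | cons h₁ q =>
  cases q with
  | nil => simp at hl
  | cons h₂ q =>
  cases q with
  | nil => simp at hl
  | cons h₃ q =>
  cases q with
  | nil => simp at hl
  | cons h₄ q =>
  cases q with
  | nil => simp at hl
  | cons h₅ q =>
  cases q with
  | nil => simp at hl
  | cons h₆ q =>
  cases q with
  | nil => simp at hl
  | cons h₇ q =>
  cases q with
  | nil => simp at hl
  | cons h₈ q =>
  cases q with
  | cons h₉ q => simp at hl
  | nil =>
  rename_i a b x y d c w
  simp only [Walk.penultimate_cons_cons, Walk.penultimate_cons_nil] at hv
  subst hv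
  have hn := hq.support_nodup
  simp only [Walk.support_cons, Walk.support_nil, List.tail_cons, List.nodup_cons, List.mem_cons,
    List.not_mem_nil, not_or, or_false] at hn
  obtain ⟨⟨ab, ax, ay, ad, ac, av, au⟩, ⟨bx, bY, bd, bc, bv, bu⟩, ⟨xy, xd, xc, xv, xu⟩,
    ⟨yd, yc, yv, yu⟩, ⟨dc, dv, du⟩, ⟨cv, cu⟩, -⟩ := hn
  refine ⟨(x, y), ⟨?_, ?_, h₄⟩, a, b, d, c, h₁, h₂, h₃, h₄, h₅, h₆, h₇, h₈, av, bu,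
    fun h => ax h.symm, cu, dv, yc, rfl⟩
  · exact (arcEdges_spec (mem_arcEdges_two h₁ h₂ h₃ av bu fun h => ax h.symm)).2.1
  · exact (arcEdges_spec (mem_arcEdges_two h₇.symm h₆.symm h₅.symm cu dv yc)).2.1

theorem exists_isOctagon {u v : V} {C : G.Subgraph}
    (hC : C ∈ {C ∈ G.cyclesOfLength 8 | s(u, v) ∈ C.edgeSet}) :
    ∃ e ∈ G.leafEdges u v, G.IsOctagon u v e C := by
  classical
  obtain ⟨⟨w, p, hp, hl, rfl⟩, he⟩ := hC
  have hu : u ∈ p.support :=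
    Walk.fst_mem_support_of_mem_edges p ((Walk.mem_edges_toSubgraph p).1 he)
  obtain ⟨q, hq, hl', hpq⟩ :
      ∃ q : G.Walk u u, q.IsCycle ∧ q.length = 8 ∧ q.toSubgraph = p.toSubgraph :=
    ⟨p.rotate u hu, hp.rotate hu, by rw [Walk.length_rotate, hl], Walk.toSubgraph_rotate p hu⟩
  rw [← hpq] at he ⊢
  -- Based at `u`, the cycle has `u v` as its first or last edge; reversal reduces the first case to
  -- the second.
  have hsnd : q.snd = v ∨ q.penultimate = v := by
    have he' := (Walk.mem_edges_toSubgraph q).1 he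
    cases q with
    | nil => simp at hl'
    | cons h q =>
      rename_i a
      obtain ⟨hq', -⟩ := (Walk.cons_isCycle_iff _ _).1 hq
      rw [Walk.edges_cons, List.mem_cons] at he'
      obtain h' | h' := he'
      · left
        simpa using (Sym2.congr_right.1 h').symm
      · right
        have hnil : ¬ q.Nil := fun hn => h.ne' hn.eq
        rw [Walk.penultimate_cons_of_not_nil _ _ hnil]
        have := hq'.reverse.eq_snd_of_mem_edges (w := v) (by simpa using h')
        rw [this, Walk.snd_reverse]
  obtain h | h := hsnd
  · have := IsOctagon.of_isCycle (v := v) hq.reverse (by simpa using hl') (by simpa using h)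
    rwa [Walk.toSubgraph_reverse] at this
  · exact IsOctagon.of_isCycle hq hl' h

theorem ncard_leafEdges (hg : G.GirthGEEight) {u v : V} (huv : G.Adj u v) :
    (G.leafEdges u v).ncard = {C ∈ G.cyclesOfLength 8 | s(u, v) ∈ C.edgeSet}.ncard := by
  have key : ∀ e ∈ G.leafEdges u v, ∃ C, G.IsOctagon u v e C := by
    rintro ⟨x, y⟩ ⟨hx, hy, hxy⟩
    obtain ⟨a, b, h₁, h₂, h₃, n₁, n₂, n₃⟩ := exists_of_mem_arcSphere_three hx
    obtain ⟨c, d, k₁, k₂, k₃, m₁, m₂, m₃⟩ := exists_of_mem_arcSphere_three hy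
    exact ⟨_, a, b, d, c, h₁, h₂, h₃, hxy, k₃.symm, k₂.symm, k₁.symm, huv.symm, n₁, n₂, n₃, m₁, m₂,
      m₃, rfl⟩
  choose f hf using key
  refine Set.ncard_congr f (fun e he => (hf e he).mem_cycles hg) ?_ ?_
  · intro e e' he he' h
    have h1 := hf e he
    have h2 := hf e' he'
    rw [h] at h1
    exact Prod.ext ((h2.eq_of_mem_verts hg h1.mem_verts.1).1 he.1)
      ((h2.eq_of_mem_verts hg h1.mem_verts.2).2 he.2.1)
  · intro C hC
    obtain ⟨e, he, h⟩ := exists_isOctagon hC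
    exact ⟨e, he, (hf e he).unique_right hg h⟩

theorem ncard_stubs (hg : G.GirthGEEight) (hc : G.IsCubic) {u v : V} (huv : G.Adj u v)
    (h : (G.leafEdges u v).ncard = 14) : (G.stubs u v).ncard = 2 := by
  obtain ⟨hf, h16⟩ := hc.card_arcEdges hg (le_refl 3) huv
  have heq : G.stubs u v = G.arcEdges 3 u v \ G.leafEdges u v := by
    ext ⟨x, y⟩
    constructor
    · rintro ⟨h1, h2⟩
      exact ⟨h1, fun h => h2 h.2.1⟩
    · rintro ⟨h1, h2⟩
      exact ⟨h1, fun h => h2 ⟨(arcEdges_spec h1).1, h, (arcEdges_spec h1).2.2⟩⟩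
  have hsub : G.leafEdges u v ⊆ G.arcEdges 3 u v := by
    rintro ⟨x, y⟩ ⟨hx, hy, hxy⟩
    refine (arcSphere_succ_step hx hxy).resolve_right fun h => ?_
    exact hg.arcSphere_disj (by omega) huv h hy
  rw [heq, Set.ncard_sdiff hsub (hf.subset hsub), h16, h]
  norm_num

/-! ### Stubs and apices -/

/-- The local properties of cubic graphs of girth eight with fourteen octagons on every edge. -/
structure HasTwoStubs (G : SimpleGraph V) : Prop where
  girth : G.GirthGEEight
  cubic : G.IsCubic
  card_stubs : ∀ ⦃u v⦄, G.Adj u v → (G.stubs u v).ncard = 2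

theorem stubs_spec (hg : G.GirthGEEight) {u v x w : V} (huv : G.Adj u v)
    (h : (x, w) ∈ G.stubs u v) : x ∈ G.arcSphere 3 u v ∧ w ∈ G.arcSphere 4 u v ∧ G.Adj x w ∧
      ∀ i ≤ 3, w ∉ G.arcSphere i u v ∧ w ∉ G.arcSphere i v u := by
  obtain ⟨h1, h2, h3⟩ := arcEdges_spec h.1
  refine ⟨h1, h2, h3, fun i hi => ⟨fun h' => ?_, fun h' => ?_⟩⟩
  · exact hg.arcSphere_disj_of_lt (by omega) (by omega) h' h2
  · by_cases hi : i = 3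
    · subst hi
      exact h.2 h'
    · exact hg.arcSphere_disj (by omega) huv h2 h'

theorem HasTwoStubs.eq_or_eq (h : G.HasTwoStubs) {u v : V} (huv : G.Adj u v) {e e' e'' : V × V}
    (he : e ∈ G.stubs u v) (he' : e' ∈ G.stubs u v) (hne : e ≠ e') (he'' : e'' ∈ G.stubs u v) :
    e'' = e ∨ e'' = e' := by
  obtain ⟨a, b, hab, heq⟩ := Set.ncard_eq_two.1 (h.card_stubs huv)
  rw [heq] at he he' he''
  simp only [Set.mem_insert_iff, Set.mem_singleton_iff] at he he' he''
  grind

/-- Every leaf of the tree at `v` is adjacent to a leaf of the tree at `u`. -/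
theorem HasTwoStubs.exists_adj_leaf (h : G.HasTwoStubs) {u v z : V} (huv : G.Adj u v)
    (hz : z ∈ G.arcSphere 3 v u) : ∃ y ∈ G.arcSphere 3 u v, G.Adj z y := by
  by_contra hcon
  push Not at hcon
  obtain ⟨b, c, h₁, h₂, h₃, n₁, n₂, n₃⟩ := exists_of_mem_arcSphere_three hz
  obtain ⟨p, q, hpq, hpc, hqc, hz'⟩ := h.cubic h₃.symm
  have hzp : G.Adj z p := (hz' p).2 (by simp)
  have hzq : G.Adj z q := (hz' q).2 (by simp)
  have sp : (z, p) ∈ G.stubs v u :=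
    ⟨mem_arcEdges_three h₁ h₂ h₃ hzp n₁ n₂ n₃ hpc, fun hp => hcon p hp hzp⟩
  have sq : (z, q) ∈ G.stubs v u :=
    ⟨mem_arcEdges_three h₁ h₂ h₃ hzq n₁ n₂ n₃ hqc, fun hq => hcon q hq hzq⟩
  have only : ∀ e ∈ G.stubs v u, e.1 = z := by
    intro e he
    obtain rfl | rfl := h.eq_or_eq huv.symm sp sq (by simpa using hpq) he <;> rfl
  have sub : ∀ r, (z, r) ∈ G.stubs v u → r ≠ c → ∀ s, G.Adj r s → s ≠ z →
      (r, s) ∈ G.stubs b v := by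
    intro r hr hrc s hrs hsz
    obtain ⟨-, -, hzr, hout⟩ := stubs_spec h.girth huv.symm hr
    refine ⟨mem_arcEdges_three h₂ h₃ hzr hrs n₂ n₃ hrc hsz, ?_⟩
    rintro ⟨k, hk, hkb, hs⟩
    by_cases hku : k = u
    · subst hku
      obtain h' | h' := arcSphere_succ_step hs hrs.symm
      · exact (hout 3 le_rfl).2 (arcEdges_spec h').2.1
      · exact (hout 1 (by omega)).2 h'
    · have hs3 : s ∈ G.arcSphere 3 v u := ⟨k, hk, hku, hs⟩
      exact hsz (only _ (mem_stubs_of_adj hs3 hrs.symm (hout 2 (by omega)).1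
        (hout 3 le_rfl).2))
  obtain ⟨s, t, hst, hsz, htz, hp'⟩ := h.cubic hzp.symm
  obtain ⟨s', t', hst', hsz', htz', hq'⟩ := h.cubic hzq.symm
  have r₁ := sub p sp hpc s ((hp' s).2 (by simp)) hsz
  have r₂ := sub p sp hpc t ((hp' t).2 (by simp)) htz
  have r₃ := sub q sq hqc s' ((hq' s').2 (by simp)) hsz'
  obtain h' | h' := h.eq_or_eq h₁.symm r₁ r₂ (by simpa using hst) r₃
  · exact hpq (Prod.ext_iff.1 h').1.symm
  · exact hpq (Prod.ext_iff.1 h').1.symm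

/-- `z` is the common end of the two stubs of the tree at `u`. -/
theorem HasTwoStubs.exists_stubs_eq (h : G.HasTwoStubs) {u v : V} (huv : G.Adj u v) :
    ∃ z x x', x ≠ x' ∧ G.stubs u v = {(x, z), (x', z)} := by
  obtain ⟨⟨x, s⟩, ⟨x', s'⟩, hne, heq⟩ := Set.ncard_eq_two.1 (h.card_stubs huv)
  have hs : (x, s) ∈ G.stubs u v := by simp [heq]
  have hs' : (x', s') ∈ G.stubs u v := by simp [heq]
  -- Otherwise `x` has four neighbours: its parent, `s`, `s'` and the leaf at `v` given by
  -- `exists_adj_leaf`.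
  have hxx : x ≠ x' := by
    rintro rfl
    obtain ⟨a, b, h₁, h₂, h₃, n₁, n₂, n₃⟩ :=
      exists_of_mem_arcSphere_three (stubs_spec h.girth huv hs).1
    obtain ⟨hx, -, hxs, hout⟩ := stubs_spec h.girth huv hs
    obtain ⟨-, -, hxs', hout'⟩ := stubs_spec h.girth huv hs'
    obtain ⟨y, hy, hxy⟩ := h.exists_adj_leaf huv.symm hx
    have hb := (arcEdges_spec (mem_arcEdges_two h₁ h₂ h₃ n₁ n₂ n₃)).1
    obtain ⟨p, q, hpq, hpb, hqb, hx'⟩ := h.cubic h₃.symm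
    have hsb : s ≠ b := fun e => (hout 2 (by omega)).1 (e ▸ hb)
    have hsb' : s' ≠ b := fun e => (hout' 2 (by omega)).1 (e ▸ hb)
    have hyb : y ≠ b := fun e => h.girth.arcSphere_disj (by omega) huv hb (e ▸ hy)
    have hys : y ≠ s := fun e => (hout 3 le_rfl).2 (e ▸ hy)
    have hys' : y ≠ s' := fun e => (hout' 3 le_rfl).2 (e ▸ hy)
    have hss : s ≠ s' := fun e => hne (by rw [e])
    have c₁ := (hx' s).1 hxs
    have c₂ := (hx' s').1 hxs'
    have c₃ := (hx' y).1 hxy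
    grind
  refine ⟨s, x, x', hxx, ?_⟩
  obtain ⟨hx, -, hxs, hout⟩ := stubs_spec h.girth huv hs
  obtain ⟨a, b, h₁, h₂, h₃, n₁, n₂, n₃⟩ := exists_of_mem_arcSphere_three hx
  have hb := (arcEdges_spec (mem_arcEdges_two h₁ h₂ h₃ n₁ n₂ n₃)).1
  have hsb : s ≠ b := fun e => (hout 2 (by omega)).1 (e ▸ hb)
  have hsa := (arcEdges_spec (mem_arcEdges_two h₂ h₃ hxs n₂ n₃ hsb)).2.1
  obtain ⟨y, ⟨k, hk, hka, hy⟩, hsy⟩ := h.exists_adj_leaf h₁ hsa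
  have hkv : k ≠ v := by
    rintro rfl
    obtain h' | h' := arcSphere_succ_step hy hsy.symm
    · exact (hout 3 le_rfl).2 (arcEdges_spec h').2.1
    · exact (hout 1 (by omega)).2 h'
  have hys := mem_stubs_of_adj ⟨k, hk, hkv, hy⟩ hsy.symm (hout 2 (by omega)).1 (hout 3 le_rfl).2
  rw [heq] at hys ⊢
  obtain h' | h' := hys
  · refine absurd (h.girth.branch_eq (i := 2) (j := 2) (by omega) hk h₁ hy ?_) hka
    have hyx : y = x := (Prod.ext_iff.1 h').1
    rw [hyx]
    exact (arcEdges_spec (mem_arcEdges_one h₂ h₃ n₂ n₃)).2.1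
  · have hss : s = s' := (Prod.ext_iff.1 h').2
    rw [hss]

/-- The common end of the two stubs of the tree at `u`, and an arbitrary vertex if there is none. -/
noncomputable def apex (G : SimpleGraph V) (u v : V) : V :=
  open Classical in if h : ∃ z x x', x ≠ x' ∧ G.stubs u v = {(x, z), (x', z)} then h.choose else u

theorem HasTwoStubs.stubs_eq (h : G.HasTwoStubs) {u v : V} (huv : G.Adj u v) :
    ∃ x x', x ≠ x' ∧ G.stubs u v = {(x, G.apex u v), (x', G.apex u v)} := by
  have := h.exists_stubs_eq huv
  rw [apex, dif_pos this]
  exact this.choose_spec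

theorem HasTwoStubs.eq_apex (h : G.HasTwoStubs) {u v x w : V} (huv : G.Adj u v)
    (hx : (x, w) ∈ G.stubs u v) : w = G.apex u v := by
  obtain ⟨y, y', -, heq⟩ := h.stubs_eq huv
  rw [heq] at hx
  obtain h' | h' := hx <;> exact (Prod.ext_iff.1 h').2

theorem HasTwoStubs.apex_not_mem (h : G.HasTwoStubs) {u v : V} (huv : G.Adj u v) {i : ℕ}
    (hi : i ≤ 3) : G.apex u v ∉ G.arcSphere i u v ∧ G.apex u v ∉ G.arcSphere i v u := by
  obtain ⟨y, y', -, heq⟩ := h.stubs_eq huv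
  exact (stubs_spec h.girth huv (x := y) (by simp [heq])).2.2.2 i hi

/-- A common apex would have four neighbours, two leaves on each side. -/
theorem HasTwoStubs.apex_ne (h : G.HasTwoStubs) {u v : V} (huv : G.Adj u v) :
    G.apex u v ≠ G.apex v u := by
  intro heq
  obtain ⟨x, x', hxx, hs⟩ := h.stubs_eq huv
  obtain ⟨y, y', hyy, ht⟩ := h.stubs_eq huv.symm
  obtain ⟨hx, -, ax, -⟩ := stubs_spec h.girth huv (x := x) (w := G.apex u v) (by simp [hs])
  obtain ⟨hx', -, ax', -⟩ := stubs_spec h.girth huv (x := x') (w := G.apex u v) (by simp [hs])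
  obtain ⟨hy, -, ay, -⟩ := stubs_spec h.girth huv.symm (x := y) (w := G.apex v u) (by simp [ht])
  obtain ⟨hy', -, ay', -⟩ := stubs_spec h.girth huv.symm (x := y') (w := G.apex v u) (by simp [ht])
  obtain ⟨p, q, -, -, -, hz⟩ := h.cubic ax.symm
  have c₁ := (hz x').1 ax'.symm
  have c₂ := (hz y).1 (heq ▸ ay.symm)
  have c₃ := (hz y').1 (heq ▸ ay'.symm)
  have hne {a b : V} (ha : a ∈ G.arcSphere 3 u v) (hb : b ∈ G.arcSphere 3 v u) : a ≠ b := by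
    rintro rfl
    exact h.girth.arcSphere_disj (by omega) huv ha hb
  have := hne hx hy
  have := hne hx hy'
  have := hne hx' hy
  have := hne hx' hy'
  grind

/-- The neighbours of an apex. -/
theorem HasTwoStubs.exists_nbrs_apex (h : G.HasTwoStubs) {u v : V} (huv : G.Adj u v) :
    ∃ x x' t, x ≠ x' ∧ x ∈ G.arcSphere 3 u v ∧ x' ∈ G.arcSphere 3 u v ∧ t ≠ x ∧ t ≠ x' ∧
      (∀ i ≤ 3, t ∉ G.arcSphere i u v ∧ t ∉ G.arcSphere i v u) ∧
      ∀ w, G.Adj (G.apex u v) w ↔ w = x ∨ w = x' ∨ w = t := by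
  obtain ⟨x, x', hxx, hs⟩ := h.stubs_eq huv
  obtain ⟨hx, -, ax, -⟩ := stubs_spec h.girth huv (x := x) (w := G.apex u v) (by simp [hs])
  obtain ⟨hx', -, ax', -⟩ := stubs_spec h.girth huv (x := x') (w := G.apex u v) (by simp [hs])
  obtain ⟨t, htx, htx', hz⟩ : ∃ t, t ≠ x ∧ t ≠ x' ∧
      ∀ w, G.Adj (G.apex u v) w ↔ w = x ∨ w = x' ∨ w = t := by
    obtain ⟨p, q, hpq, hpx, hqx, hz⟩ := h.cubic ax.symm
    obtain rfl | rfl | rfl := (hz x').1 ax'.symm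
    · exact absurd rfl hxx
    · exact ⟨q, hqx, hpq.symm, hz⟩
    · exact ⟨p, hpx, hpq, fun w => by rw [hz w]; tauto⟩
  refine ⟨x, x', t, hxx, hx, hx', htx, htx', ?_, hz⟩
  have hzt : G.Adj (G.apex u v) t := (hz t).2 (by simp)
  have aux : ∀ i ≤ 2, ∀ p q, (∀ j ≤ 3, G.apex u v ∉ G.arcSphere j p q) →
      G.apex u v ≠ q → t ∉ G.arcSphere i p q := by
    intro i hi p q hout hq ht
    obtain h' | ⟨-, h'⟩ | ⟨m, hm, h'⟩ := arcSphere_step ht hzt.symm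
    · exact hout _ (by omega) (arcEdges_spec h').2.1
    · exact hq h'
    · exact hout _ (by omega) h'
  intro i hi
  obtain hi | rfl := Nat.lt_succ_iff_lt_or_eq.1 (Nat.lt_succ_of_le hi)
  · exact ⟨aux i (by omega) u v (fun j hj => (h.apex_not_mem huv hj).1)
      (h.apex_not_mem huv (Nat.zero_le 3)).2,
      aux i (by omega) v u (fun j hj => (h.apex_not_mem huv hj).2)
      (h.apex_not_mem huv (Nat.zero_le 3)).1⟩
  · constructor
    · intro ht
      have := mem_stubs_of_adj ht hzt.symm (h.apex_not_mem huv (by omega)).1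
        (h.apex_not_mem huv le_rfl).2
      rw [hs] at this
      obtain h' | h' := this
      · exact htx (Prod.ext_iff.1 h').1
      · exact htx' (Prod.ext_iff.1 h').1
    · intro ht
      exact h.apex_ne huv (h.eq_apex huv.symm (mem_stubs_of_adj ht hzt.symm
        (h.apex_not_mem huv (by omega)).2 (h.apex_not_mem huv le_rfl).1))

/-! ### The ball around an edge is closed under adjacency -/

/-- The two trees of depth three at an edge, together with the two apices. -/
def edgeBall (G : SimpleGraph V) (u v : V) : Set V :=
  {x | (∃ i ≤ 3, x ∈ G.arcSphere i u v ∨ x ∈ G.arcSphere i v u) ∨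
    x = G.apex u v ∨ x = G.apex v u}

theorem edgeBall_comm (u v : V) : G.edgeBall u v = G.edgeBall v u := by
  ext x
  simp only [edgeBall, Set.mem_ofPred_eq, or_comm]

theorem HasTwoStubs.mem_edgeBall_of_mem_arcSphere (h : G.HasTwoStubs) {u v x y : V}
    (huv : G.Adj u v) {i : ℕ} (hi : i ≤ 3) (hx : x ∈ G.arcSphere i u v) (hxy : G.Adj x y) :
    y ∈ G.edgeBall u v := by
  obtain hi | rfl := Nat.lt_succ_iff_lt_or_eq.1 (Nat.lt_succ_of_le hi)
  · obtain h' | ⟨-, h'⟩ | ⟨m, hm, h'⟩ := arcSphere_step hx hxy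
    · exact Or.inl ⟨i + 1, by omega, Or.inl (arcEdges_spec h').2.1⟩
    · exact Or.inl ⟨0, by omega, Or.inr h'⟩
    · exact Or.inl ⟨m, by omega, Or.inl h'⟩
  · by_cases h2 : y ∈ G.arcSphere 2 u v
    · exact Or.inl ⟨2, by omega, Or.inl h2⟩
    · by_cases h3 : y ∈ G.arcSphere 3 v u
      · exact Or.inl ⟨3, by omega, Or.inr h3⟩
      · exact Or.inr (Or.inl (h.eq_apex huv (mem_stubs_of_adj hx hxy h2 h3)))

/-- The only edges that leave the ball around an edge start at one of the apices. -/
theorem HasTwoStubs.apex_of_not_mem (h : G.HasTwoStubs) {u v x y : V} (huv : G.Adj u v)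
    (hx : x ∈ G.edgeBall u v) (hxy : G.Adj x y) (hy : y ∉ G.edgeBall u v) :
    x = G.apex u v ∨ x = G.apex v u := by
  obtain ⟨i, hi, h' | h'⟩ | h' := hx
  · exact absurd (h.mem_edgeBall_of_mem_arcSphere huv hi h' hxy) hy
  · rw [edgeBall_comm] at hy
    exact absurd (h.mem_edgeBall_of_mem_arcSphere huv.symm hi h' hxy) hy
  · exact h'

theorem exists_of_mem_arcSphere_two {u v x : V} (h : x ∈ G.arcSphere 2 u v) :
    ∃ a, G.Adj u a ∧ G.Adj a x ∧ a ≠ v ∧ x ≠ u := by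
  obtain ⟨a, ha, hav, b, hb, hbu, rfl⟩ := h
  exact ⟨a, ha, hb, hav, hbu⟩

theorem IsCubic.exists_arcSphere_two (hc : G.IsCubic) {u v : V} (huv : G.Adj u v) :
    ∃ a b, G.Adj u a ∧ a ≠ v ∧ G.Adj a b ∧ b ≠ u := by
  obtain ⟨a, a', -, hav, -, ha⟩ := hc huv
  have hua : G.Adj u a := (ha a).2 (by simp)
  obtain ⟨b, b', -, hbu, -, hb⟩ := hc hua.symm
  exact ⟨a, b, hua, hav, (hb b).2 (by simp), hbu⟩

/-- Otherwise only `z t` and `w s` can leave the ball, where `t` and `s` are the third neighbours of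
the apices `z` and `w`. By `exists_adj_leaf` at the edge `z t`, each of the two further branches at
`t` must return to the ball. It can do so only along `s w`, and both branches doing so contradicts
the girth. -/
theorem HasTwoStubs.apex_adj_apex (h : G.HasTwoStubs) {u v : V} (huv : G.Adj u v) :
    G.Adj (G.apex u v) (G.apex v u) := by
  by_contra hnadj
  obtain ⟨x, x', t, -, hx, hx', htx, htx', hout, hz⟩ := h.exists_nbrs_apex huv
  obtain ⟨y, y', s, -, hy, hy', -, -, -, hw⟩ := h.exists_nbrs_apex huv.symm
  have hne := h.apex_ne huv
  have hzout := fun {i : ℕ} (hi : i ≤ 3) => h.apex_not_mem huv hi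
  have hwout := fun {i : ℕ} (hi : i ≤ 3) => h.apex_not_mem huv.symm hi
  generalize hzdef : G.apex u v = z at *
  generalize hwdef : G.apex v u = w at *
  have hzt : G.Adj z t := (hz t).2 (by simp)
  have htS : t ∉ G.edgeBall u v := by
    rintro (⟨i, hi, h' | h'⟩ | h' | h')
    · exact (hout i hi).1 h'
    · exact (hout i hi).2 h'
    · exact hzt.ne (by rw [h', hzdef])
    · exact hnadj (by rw [← hwdef, ← h']; exact hzt)
  have cross : ∀ p q, p ∈ G.edgeBall u v → G.Adj p q → q ∉ G.edgeBall u v →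
      (p = z ∧ q = t) ∨ (p = w ∧ q = s) := by
    intro p q hp hpq hq
    obtain rfl | rfl := h.apex_of_not_mem huv hp hpq hq
    · rw [hzdef] at hpq ⊢
      obtain rfl | rfl | rfl := (hz q).1 hpq
      · exact absurd (Or.inl ⟨3, le_rfl, Or.inl hx⟩) hq
      · exact absurd (Or.inl ⟨3, le_rfl, Or.inl hx'⟩) hq
      · exact Or.inl ⟨rfl, rfl⟩
    · rw [hwdef] at hpq ⊢
      obtain rfl | rfl | rfl := (hw q).1 hpq
      · exact absurd (Or.inl ⟨3, le_rfl, Or.inr hy⟩) hq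
      · exact absurd (Or.inl ⟨3, le_rfl, Or.inr hy'⟩) hq
      · exact Or.inr ⟨rfl, rfl⟩
  -- Two of the three steps reach a neighbour of a leaf at `u`. It is not `w`, which would then be
  -- the apex `z`, so the third step cannot leave the ball.
  have leaf : ∀ g ∈ G.arcSphere 3 z t, g ∈ G.edgeBall u v := by
    intro g hg
    obtain ⟨k, l, hk, hl, hg, hkt, hlz, hgk⟩ := exists_of_mem_arcSphere_three hg
    have hk3 : k ∈ G.arcSphere 3 u v := by
      obtain rfl | rfl | rfl := (hz k).1 hk
      exacts [hx, hx', absurd rfl hkt]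
    have hlS := h.mem_edgeBall_of_mem_arcSphere huv le_rfl hk3 hl
    by_contra hgS
    obtain ⟨h', -⟩ | ⟨rfl, -⟩ := cross l g hlS hg hgS
    · exact hlz h'
    · refine hne ?_
      rw [h.eq_apex huv (mem_stubs_of_adj hk3 hl (hwout (by omega)).2 (hwout le_rfl).1), hzdef]
  -- If the branch avoids `s`, then `c`, `e`, `f` all stay outside the ball, while `f` is adjacent
  -- to some leaf at `z`, which lies inside.
  have branch : ∀ c, G.Adj t c → c ≠ z → (c = w ∧ t = s) ∨ ∃ i ≤ 2, s ∈ G.arcSphere i c t := by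
    intro c hc hcz
    obtain ⟨e, f, he, het, hf, hfc⟩ := h.cubic.exists_arcSphere_two hc.symm
    by_contra hcon
    push Not at hcon
    obtain ⟨hcon, hs⟩ := hcon
    have hsc : c ≠ s := fun e' => hs 0 (by omega) e'.symm
    have hse : e ≠ s := fun e' => hs 1 (by omega) (e' ▸ ⟨e, he, het, rfl⟩)
    have hsf : f ≠ s := fun e' => hs 2 (by omega) (e' ▸ ⟨e, he, het, f, hf, hfc, rfl⟩)
    have hcS : c ∉ G.edgeBall u v := fun hcS => by
      obtain ⟨h', -⟩ | ⟨h', h''⟩ := cross c t hcS hc.symm htS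
      exacts [hcz h', hcon h' h'']
    have heS : e ∉ G.edgeBall u v := fun heS => by
      obtain ⟨-, h'⟩ | ⟨-, h'⟩ := cross e c heS he.symm hcS
      exacts [hc.ne' h', hsc h']
    have hfS : f ∉ G.edgeBall u v := fun hfS => by
      obtain ⟨-, h'⟩ | ⟨-, h'⟩ := cross f e hfS hf.symm heS
      exacts [het h', hse h']
    obtain ⟨g, hg, hfg⟩ := h.exists_adj_leaf (z := f) hzt
      (arcEdges_spec (mem_arcEdges_two hc he hf hcz het hfc)).2.1
    obtain ⟨rfl, -⟩ | ⟨-, h'⟩ := cross g f (leaf g hg) hfg.symm hfS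
    · exact h.girth.arcSphere_disj_of_lt (by omega) (by omega : 0 < 3) rfl hg
    · exact hsf h'
  obtain ⟨c, c', hcc, hcz, hcz', ht⟩ := h.cubic hzt.symm
  have hc : G.Adj t c := (ht c).2 (by simp)
  have hc' : G.Adj t c' := (ht c').2 (by simp)
  have notself : ∀ k, G.Adj t k → ∀ i ≤ 2, t ∉ G.arcSphere i k t := fun k hk i hi h' =>
    h.girth.arcSphere_disj (j := 0) (by omega) hk.symm h' rfl
  obtain ⟨rfl, rfl⟩ | ⟨i, hi, h₁⟩ := branch c hc hcz
  · obtain ⟨h', -⟩ | ⟨j, hj, h₂⟩ := branch c' hc' hcz'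
    · exact hcc h'.symm
    · exact notself c' hc' j hj h₂
  · obtain ⟨-, rfl⟩ | ⟨j, hj, h₂⟩ := branch c' hc' hcz'
    · exact notself c hc i hi h₁
    · exact hcc (h.girth.branch_eq (by omega) hc hc' h₁ h₂)

theorem HasTwoStubs.mem_edgeBall_of_adj (h : G.HasTwoStubs) {u v x y : V} (huv : G.Adj u v)
    (hx : x ∈ G.edgeBall u v) (hxy : G.Adj x y) : y ∈ G.edgeBall u v := by
  have aux : ∀ {u v : V}, G.Adj u v → G.Adj (G.apex u v) y → y ∈ G.edgeBall u v := by
    intro u v huv hy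
    obtain ⟨x, x', t, -, hx, hx', htx, htx', hout, hz⟩ := h.exists_nbrs_apex huv
    have ht : G.apex v u = t := by
      obtain h' | h' | h' := (hz _).1 (h.apex_adj_apex huv)
      · exact absurd (h' ▸ hx) (h.apex_not_mem huv.symm le_rfl).2
      · exact absurd (h' ▸ hx') (h.apex_not_mem huv.symm le_rfl).2
      · exact h'
    obtain rfl | rfl | rfl := (hz y).1 hy
    · exact Or.inl ⟨3, le_rfl, Or.inl hx⟩
    · exact Or.inl ⟨3, le_rfl, Or.inl hx'⟩
    · exact Or.inr (Or.inr ht.symm)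
  by_contra hy
  obtain rfl | rfl := h.apex_of_not_mem huv hx hxy hy
  · exact hy (aux huv hxy)
  · exact hy (edgeBall_comm u v ▸ aux huv.symm hxy)

/-! ### Independence of the chosen neighbour and involutivity -/

theorem HasTwoStubs.apex_nbrs (h : G.HasTwoStubs) {u v : V} (huv : G.Adj u v) :
    ∃ x x', x ≠ x' ∧ x ∈ G.arcSphere 3 u v ∧ x' ∈ G.arcSphere 3 u v ∧
      ∀ w, G.Adj (G.apex u v) w ↔ w = x ∨ w = x' ∨ w = G.apex v u := by
  obtain ⟨x, x', t, hxx, hx, hx', htx, htx', hout, hz⟩ := h.exists_nbrs_apex huv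
  obtain h' | h' | h' := (hz _).1 (h.apex_adj_apex huv)
  · exact absurd (h' ▸ hx) (h.apex_not_mem huv.symm le_rfl).2
  · exact absurd (h' ▸ hx') (h.apex_not_mem huv.symm le_rfl).2
  · exact ⟨x, x', hxx, hx, hx', h' ▸ hz⟩

/-- For `v ≠ w`, `z = apex u w` has a leaf neighbour in each branch at `u` away from `w`, since two
in one branch would close a hexagon. So `z` is a leaf at `v` for the edge `v u`, and its neighbour
`apex w u` ends a stub there. -/
theorem HasTwoStubs.apex_congr (h : G.HasTwoStubs) {u v w : V} (huv : G.Adj u v)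
    (huw : G.Adj u w) : G.apex v u = G.apex w u := by
  by_cases hvw : v = w
  · rw [hvw]
  have aux : ∀ {x x' z k : V}, x ≠ x' → G.Adj u k → x ∈ G.arcSphere 2 k u →
      x' ∈ G.arcSphere 2 k u → G.Adj x z → G.Adj x' z → (∀ i ≤ 3, z ∉ G.arcSphere i u w) → k ≠ w →
      False := by
    intro x x' z k hxx hk hx hx' hz hz' hout hkw
    have hz1 : z ∉ G.arcSphere 1 k u := fun h' => hout 2 (by omega) ⟨k, hk, hkw, h'⟩
    exact hxx (h.girth.arcEdges_inj le_rfl ((arcSphere_succ_step hx hz).resolve_right hz1)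
      ((arcSphere_succ_step hx' hz').resolve_right hz1))
  have main : ∀ {x z : V}, G.Adj x z → G.Adj z (G.apex w u) →
      (∀ i ≤ 3, z ∉ G.arcSphere i u w) →
      x ∈ G.arcSphere 2 v u → G.apex v u = G.apex w u := by
    intro x z hxz hzw hout hx
    have hz : z ∈ G.arcSphere 3 v u := by
      refine (arcEdges_spec ((arcSphere_succ_step hx hxz).resolve_right fun h' => ?_)).2.1
      exact hout 2 (by omega) ⟨v, huv, hvw, h'⟩
    symm
    refine h.eq_apex huv.symm (mem_stubs_of_adj hz hzw ?_ ?_)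
    · exact fun h' => (h.apex_not_mem huw.symm le_rfl).2 ⟨v, huv, hvw, h'⟩
    · rintro ⟨k, hk, hkv, h'⟩
      by_cases hkw : k = w
      · subst hkw
        exact (h.apex_not_mem huw.symm (by omega : 2 ≤ 3)).1 h'
      · exact (h.apex_not_mem huw.symm le_rfl).2 ⟨k, hk, hkw, h'⟩
  obtain ⟨x, x', hxx, ⟨k, hk, hkw, hx⟩, ⟨k', hk', hkw', hx'⟩, hz⟩ := h.apex_nbrs huw
  have hzx := (hz x).2 (by simp)
  have hzx' := (hz x').2 (by simp)
  have hout := fun i (hi : i ≤ 3) => (h.apex_not_mem huw hi).1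
  have hkk : k ≠ k' := by
    rintro rfl
    exact aux hxx hk hx hx' hzx.symm hzx'.symm hout hkw
  obtain ⟨p, q, -, -, -, hu⟩ := h.cubic huv
  have c₁ := (hu k).1 hk
  have c₂ := (hu k').1 hk'
  have c₃ := (hu w).1 huw
  have hkv : k = v ∨ k' = v := by grind
  obtain rfl | rfl := hkv
  · exact main hzx.symm (h.apex_adj_apex huw) hout hx
  · exact main hzx'.symm (h.apex_adj_apex huw) hout hx'

/-- Walking back from `apex u v` along a branch to `u` gives an onward arc `(a, u)` for the edge of
apices. Were it not a stub, `u` would be two steps from a leaf at `v`, hence at depth 1, 3 or 5 in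
the tree at `v`, against the girth. -/
theorem HasTwoStubs.apex_apex (h : G.HasTwoStubs) {u v : V} (huv : G.Adj u v) :
    G.apex (G.apex u v) (G.apex v u) = u := by
  have hzw := h.apex_adj_apex huv
  obtain ⟨x, x', -, hx, hx', hz⟩ := h.apex_nbrs huv
  obtain ⟨y, y', -, hy, hy', hw⟩ := h.apex_nbrs huv.symm
  have hzx := (hz x).2 (by simp)
  obtain ⟨a, b, h₁, h₂, h₃, n₁, n₂, n₃⟩ := exists_of_mem_arcSphere_three hx
  have hbz : b ≠ G.apex u v := fun e =>
    (h.apex_not_mem huv (by omega : 2 ≤ 3)).1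
      (e ▸ (arcEdges_spec (mem_arcEdges_one h₁ h₂ n₁ n₂)).2.1)
  have hxw : x ≠ G.apex v u := fun e => (h.apex_not_mem huv.symm le_rfl).2 (e ▸ hx)
  symm
  refine h.eq_apex hzw (x := a) ⟨mem_arcEdges_three hzx h₃.symm h₂.symm h₁.symm hxw hbz n₃.symm
    n₂.symm, ?_⟩
  rintro ⟨k, hk, hkz, hu⟩
  have hk3 : k ∈ G.arcSphere 3 v u := by
    obtain rfl | rfl | rfl := (hw k).1 hk
    exacts [hy, hy', absurd rfl hkz]
  obtain ⟨l, hkl, hlu, -, -⟩ := exists_of_mem_arcSphere_two hu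
  have hu0 : u ∈ G.arcSphere 0 u v := rfl
  have hno : ∀ i ≤ 6, u ∉ G.arcSphere i v u := fun i hi h' =>
    h.girth.arcSphere_disj (by omega) huv hu0 h'
  obtain h' | h' := arcSphere_succ_step hk3 hkl
  · obtain h'' | h'' := arcSphere_succ_step (arcEdges_spec h').2.1 hlu
    · exact hno 5 (by omega) (arcEdges_spec h'').2.1
    · exact hno 3 (by omega) h''
  · obtain h'' | h'' := arcSphere_succ_step h' hlu
    · exact hno 3 (by omega) (arcEdges_spec h'').2.1
    · exact hno 1 (by omega) h''

/-! ### Size of the ball -/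

theorem IsCubic.ncard_ball (hc : G.IsCubic) (hg : G.GirthGEEight) {u v : V} (huv : G.Adj u v) :
    {x | ∃ i ≤ 3, x ∈ G.arcSphere i u v}.Finite ∧
      {x | ∃ i ≤ 3, x ∈ G.arcSphere i u v}.ncard = 15 := by
  have heq : {x | ∃ i ≤ 3, x ∈ G.arcSphere i u v} = ((G.arcSphere 0 u v ∪ G.arcSphere 1 u v) ∪
      G.arcSphere 2 u v) ∪ G.arcSphere 3 u v := by
    ext x
    constructor
    · rintro ⟨i, hi, hx⟩
      interval_cases i
      exacts [Or.inl (Or.inl (Or.inl hx)), Or.inl (Or.inl (Or.inr hx)), Or.inl (Or.inr hx),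
        Or.inr hx]
    · rintro (((hx | hx) | hx) | hx)
      exacts [⟨0, by omega, hx⟩, ⟨1, by omega, hx⟩, ⟨2, by omega, hx⟩, ⟨3, by omega, hx⟩]
  obtain ⟨f₀, c₀⟩ := hc.card_arcSphere hg (by omega : 0 ≤ 3) huv
  obtain ⟨f₁, c₁⟩ := hc.card_arcSphere hg (by omega : 1 ≤ 3) huv
  obtain ⟨f₂, c₂⟩ := hc.card_arcSphere hg (by omega : 2 ≤ 3) huv
  obtain ⟨f₃, c₃⟩ := hc.card_arcSphere hg (by omega : 3 ≤ 3) huv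
  have hd {i j : ℕ} (hij : i < j) (hj : j ≤ 3) {x : V} (hx : x ∈ G.arcSphere i u v)
      (hx' : x ∈ G.arcSphere j u v) : False := hg.arcSphere_disj_of_lt (by omega) hij hx hx'
  rw [heq]
  refine ⟨((f₀.union f₁).union f₂).union f₃, ?_⟩
  rw [Set.ncard_union_eq _ ((f₀.union f₁).union f₂) f₃, Set.ncard_union_eq _ (f₀.union f₁) f₂,
    Set.ncard_union_eq _ f₀ f₁, c₀, c₁, c₂, c₃]
  · norm_num
  · exact Set.disjoint_left.2 fun x hx hx' => hd (by omega) (by omega) hx hx'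
  · refine Set.disjoint_left.2 ?_
    rintro x (hx | hx) hx'
    exacts [hd (by omega) (by omega) hx hx', hd (by omega) (by omega) hx hx']
  · refine Set.disjoint_left.2 ?_
    rintro x ((hx | hx) | hx) hx'
    exacts [hd (by omega) (by omega) hx hx', hd (by omega) (by omega) hx hx',
      hd (by omega) (by omega) hx hx']

theorem HasTwoStubs.ncard_edgeBall (h : G.HasTwoStubs) {u v : V} (huv : G.Adj u v) :
    (G.edgeBall u v).ncard = 32 := by
  obtain ⟨f₁, c₁⟩ := h.cubic.ncard_ball h.girth huv
  obtain ⟨f₂, c₂⟩ := h.cubic.ncard_ball h.girth huv.symm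
  have heq : G.edgeBall u v = ({x | ∃ i ≤ 3, x ∈ G.arcSphere i u v} ∪
      {x | ∃ i ≤ 3, x ∈ G.arcSphere i v u}) ∪ {G.apex u v, G.apex v u} := by
    ext x
    simp only [edgeBall, Set.mem_ofPred_eq, Set.mem_union, Set.mem_insert_iff,
      Set.mem_singleton_iff, and_or_left, exists_or]
  rw [heq, Set.ncard_union_eq _ (f₁.union f₂) (by simp), Set.ncard_union_eq _ f₁ f₂, c₁, c₂,
    Set.ncard_pair (h.apex_ne huv)]
  · refine Set.disjoint_left.2 ?_
    rintro x ⟨i, hi, hx⟩ ⟨j, hj, hx'⟩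
    exact h.girth.arcSphere_disj (by omega) huv hx hx'
  · refine Set.disjoint_left.2 ?_
    rintro x (⟨i, hi, hx⟩ | ⟨i, hi, hx⟩) (rfl | rfl)
    exacts [(h.apex_not_mem huv hi).1 hx, (h.apex_not_mem huv.symm hi).2 hx,
      (h.apex_not_mem huv hi).2 hx, (h.apex_not_mem huv.symm hi).1 hx]

/-! ### The antipodal automorphism -/

/-- The vertex at distance five from `u`; isolated vertices are left fixed. -/
noncomputable def opposite (G : SimpleGraph V) (u : V) : V :=
  open Classical in if h : ∃ v, G.Adj u v then G.apex h.choose u else u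

theorem HasTwoStubs.opposite_eq (h : G.HasTwoStubs) {u v : V} (huv : G.Adj u v) :
    G.opposite u = G.apex v u := by
  have hex : ∃ v, G.Adj u v := ⟨v, huv⟩
  rw [opposite, dif_pos hex]
  exact h.apex_congr hex.choose_spec huv

theorem HasTwoStubs.opposite_adj (h : G.HasTwoStubs) {u v : V} (huv : G.Adj u v) :
    G.Adj (G.opposite u) (G.opposite v) := by
  rw [h.opposite_eq huv, h.opposite_eq huv.symm]
  exact h.apex_adj_apex huv.symm

theorem HasTwoStubs.opposite_involutive (h : G.HasTwoStubs) : Function.Involutive G.opposite := by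
  intro u
  by_cases hex : ∃ v, G.Adj u v
  · obtain ⟨v, huv⟩ := hex
    rw [h.opposite_eq huv, h.opposite_eq (h.apex_adj_apex huv.symm), h.apex_apex huv]
  · have : G.opposite u = u := by rw [opposite, dif_neg hex]
    rw [this, this]

theorem HasTwoStubs.opposite_adj_iff (h : G.HasTwoStubs) {u v : V} :
    G.Adj (G.opposite u) (G.opposite v) ↔ G.Adj u v := by
  refine ⟨fun huv => ?_, h.opposite_adj⟩
  have := h.opposite_adj huv
  rwa [h.opposite_involutive, h.opposite_involutive] at this

theorem HasTwoStubs.not_adj_opposite (h : G.HasTwoStubs) (u : V) : ¬ G.Adj u (G.opposite u) := by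
  intro hu
  have hu' := hu
  rw [h.opposite_eq hu] at hu'
  have hu0 : u ∈ G.arcSphere 0 u (G.opposite u) := rfl
  obtain h' | ⟨-, h'⟩ | ⟨m, hm, h'⟩ := arcSphere_step hu0 hu'
  · exact (h.apex_not_mem hu.symm (by omega : 1 ≤ 3)).2 (arcEdges_spec h').2.1
  · exact (h.apex_not_mem hu.symm (by omega : 0 ≤ 3)).1 h'
  · omega

theorem exists_adj_of_mem_arcSphere {n : ℕ} {u v x : V} (huv : G.Adj u v)
    (hx : x ∈ G.arcSphere n u v) : ∃ y, G.Adj x y := by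
  induction n generalizing u v with
  | zero =>
    obtain rfl : x = u := hx
    exact ⟨v, huv⟩
  | succ n ih =>
    obtain ⟨a, ha, -, hx⟩ := hx
    exact ih ha.symm hx

section Closed

variable {S : Set V}

theorem arcSphere_subset_of_closed (hS : ∀ ⦃x y⦄, x ∈ S → G.Adj x y → y ∈ S) {n : ℕ} {u v : V}
    (hu : u ∈ S) : G.arcSphere n u v ⊆ S := by
  induction n generalizing u v with
  | zero => exact Set.singleton_subset_iff.2 hu
  | succ n ih =>
    rintro x ⟨a, ha, -, hx⟩
    exact ih (hS hu ha) hx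

theorem HasTwoStubs.opposite_mem_of_closed (h : G.HasTwoStubs)
    (hS : ∀ ⦃x y⦄, x ∈ S → G.Adj x y → y ∈ S) {u : V} (hu : u ∈ S) : G.opposite u ∈ S := by
  by_cases hex : ∃ v, G.Adj u v
  · obtain ⟨v, huv⟩ := hex
    rw [h.opposite_eq huv]
    obtain ⟨x, x', -, hx, -, hz⟩ := h.apex_nbrs huv.symm
    exact hS (arcSphere_subset_of_closed hS (hS hu huv) hx) ((hz x).2 (by simp)).symm
  · rwa [opposite, dif_neg hex]

end Closed

/-! ### Walk counts and the trace modulo five -/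

section Matrix

variable [Fintype V] [DecidableEq V] [DecidableRel G.Adj]

theorem adjMatrix_pow_succ_apply {R : Type*} [Semiring R] (n : ℕ) (u w : V) :
    (G.adjMatrix R ^ (n + 1)) u w = ∑ a ∈ G.neighborFinset u, (G.adjMatrix R ^ n) a w := by
  rw [pow_succ', adjMatrix_mul_apply]

theorem adjMatrix_pow_succ_apply' {R : Type*} [Semiring R] (n : ℕ) (u w : V) :
    (G.adjMatrix R ^ (n + 1)) u w = ∑ a ∈ G.neighborFinset w, (G.adjMatrix R ^ n) u a := by
  rw [pow_succ, mul_adjMatrix_apply]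

/-- Walks may backtrack and pass through `v`; the reference vertex `v` only decides on which side
the end is recorded. -/
theorem mem_arcSphere_of_adjMatrix_pow_ne_zero {R : Type*} [Semiring R] {n : ℕ} {u v w : V}
    (h : (G.adjMatrix R ^ n) u w ≠ 0) :
    ∃ i ≤ n, w ∈ G.arcSphere i u v ∨ w ∈ G.arcSphere i v u := by
  have step : ∀ {n : ℕ} {u v q w : V}, (∃ i ≤ n, q ∈ G.arcSphere i u v) → G.Adj q w →
      ∃ i ≤ n + 1, w ∈ G.arcSphere i u v ∨ w ∈ G.arcSphere i v u := by
    rintro n u v q w ⟨i, hi, hq⟩ hqw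
    obtain h' | ⟨-, h'⟩ | ⟨m, hm, h'⟩ := arcSphere_step hq hqw
    · exact ⟨i + 1, by omega, Or.inl (arcEdges_spec h').2.1⟩
    · exact ⟨0, by omega, Or.inr h'⟩
    · exact ⟨m, by omega, Or.inl h'⟩
  induction n generalizing w with
  | zero =>
    rw [pow_zero, Matrix.one_apply] at h
    exact ⟨0, le_rfl, Or.inl (by_contra fun hw => h (if_neg fun e => hw e.symm))⟩
  | succ n ih =>
    rw [adjMatrix_pow_succ_apply'] at h
    obtain ⟨q, hq, hne⟩ := Finset.exists_ne_zero_of_sum_ne_zero h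
    have hqw : G.Adj q w := ((mem_neighborFinset _ _ _).1 hq).symm
    obtain ⟨i, hi, h' | h'⟩ := ih hne
    · exact step ⟨i, hi, h'⟩ hqw
    · obtain ⟨j, hj, h''⟩ := step ⟨i, hi, h'⟩ hqw
      exact ⟨j, hj, h''.symm⟩

/-- Seen from the edge `u b` with `b ≠ a`, `w` has depth `n + 1` on the side of `u`, so no walk of
length `n` from `b` reaches it. -/
theorem GirthGEEight.adjMatrix_pow_apply_eq_one {R : Type*} [Semiring R] (hg : G.GirthGEEight)
    {n : ℕ} (hn : n ≤ 3) {u v w : V} (huv : G.Adj u v) (hw : w ∈ G.arcSphere n u v) :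
    (G.adjMatrix R ^ n) u w = 1 := by
  induction n generalizing u v with
  | zero =>
    obtain rfl : w = u := hw
    simp
  | succ n ih =>
    obtain ⟨a, ha, hav, hw⟩ := hw
    rw [adjMatrix_pow_succ_apply, Finset.sum_eq_single_of_mem a (by simpa using ha),
      ih (by omega) ha.symm hw]
    intro b hb hba
    have hub : G.Adj u b := (mem_neighborFinset _ _ _).1 hb
    have hw' : w ∈ G.arcSphere (n + 1) u b := ⟨a, ha, hba.symm, hw⟩
    by_contra hne
    obtain ⟨i, hi, h' | h'⟩ := mem_arcSphere_of_adjMatrix_pow_ne_zero (v := u) hne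
    · exact hg.arcSphere_disj (by omega) hub hw' h'
    · exact hg.arcSphere_disj_of_lt (by omega) (by omega) h' hw'

theorem HasTwoStubs.adjMatrix_pow_four_apply {R : Type*} [Semiring R] (h : G.HasTwoStubs)
    {u v : V} (huv : G.Adj u v) : (G.adjMatrix R ^ 4) u (G.apex u v) = 2 := by
  obtain ⟨x, x', hxx, hx, hx', hz⟩ := h.apex_nbrs huv
  have hN : G.neighborFinset (G.apex u v) = {x, x', G.apex v u} := by
    ext w
    simp [hz]
  have h0 : (G.adjMatrix R ^ 3) u (G.apex v u) = 0 := by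
    by_contra hne
    obtain ⟨i, hi, h' | h'⟩ := mem_arcSphere_of_adjMatrix_pow_ne_zero (v := v) hne
    exacts [(h.apex_not_mem huv.symm hi).2 h', (h.apex_not_mem huv.symm hi).1 h']
  have hne {y : V} (hy : y ∈ G.arcSphere 3 u v) : y ≠ G.apex v u := fun e =>
    (h.apex_not_mem huv.symm le_rfl).2 (e ▸ hy)
  rw [adjMatrix_pow_succ_apply', hN, Finset.sum_insert (by simp [hxx, hne hx]),
    Finset.sum_insert (by simp [hne hx']), Finset.sum_singleton, h0,
    h.girth.adjMatrix_pow_apply_eq_one le_rfl huv hx,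
    h.girth.adjMatrix_pow_apply_eq_one le_rfl huv hx', add_zero, one_add_one_eq_two]

/-- Each of the three neighbours `w` of `u` has `apex w u = opposite u`, reached from `w` by two
walks of length four. -/
theorem HasTwoStubs.adjMatrix_pow_five_apply {R : Type*} [Semiring R] (h : G.HasTwoStubs)
    {u v : V} (huv : G.Adj u v) : (G.adjMatrix R ^ 5) u (G.opposite u) = 6 := by
  obtain ⟨a, b, hab, hav, hbv, hu⟩ := h.cubic huv
  have hN : G.neighborFinset u = {v, a, b} := by
    ext w
    simp [hu]
  have hcard : (G.neighborFinset u).card = 3 := by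
    rw [hN, Finset.card_eq_three]
    exact ⟨v, a, b, hav.symm, hbv.symm, hab, rfl⟩
  rw [adjMatrix_pow_succ_apply, Finset.sum_congr rfl (g := fun _ => (2 : R)), Finset.sum_const,
    hcard]
  · norm_num
  · intro w hw
    have huw : G.Adj u w := (mem_neighborFinset _ _ _).1 hw
    rw [h.opposite_eq huw, h.adjMatrix_pow_four_apply huw.symm]

theorem HasTwoStubs.not_adj (h : G.HasTwoStubs) (u₀ v₀ : V) : ¬ G.Adj u₀ v₀ := by
  classical
  intro hadj
  set S := G.edgeBall u₀ v₀ with hSdef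
  have hS : ∀ ⦃x y⦄, x ∈ S → G.Adj x y → y ∈ S := fun x y hx hxy =>
    h.mem_edgeBall_of_adj hadj hx hxy
  have hSadj : ∀ x ∈ S, ∃ y, G.Adj x y := by
    rintro x (⟨i, hi, hx | hx⟩ | rfl | rfl)
    exacts [exists_adj_of_mem_arcSphere hadj hx, exists_adj_of_mem_arcSphere hadj.symm hx,
      ⟨_, h.apex_adj_apex hadj⟩, ⟨_, h.apex_adj_apex hadj.symm⟩]
  let σ : V ≃ V := h.opposite_involutive.toPerm
  let A := G.adjMatrix (ZMod 5)
  let B := A.submatrix id σ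
  -- As `σ` is an involutive automorphism, permuting columns or rows of `A` gives the same matrix.
  have hB : B = A.submatrix σ id := by
    ext x y
    have := h.opposite_adj_iff (u := x) (v := G.opposite y)
    rw [h.opposite_involutive] at this
    simp only [B, A, σ, Matrix.submatrix_apply, adjMatrix_apply, id, Function.Involutive.coe_toPerm,
      this]
  have hB2 : B * B = A * A := by
    nth_rewrite 2 [hB]
    simp only [B, Matrix.submatrix_mul_equiv, Matrix.submatrix_id_id]
  have hB5 : B ^ 5 = (A ^ 5).submatrix id σ := by
    have h4 : B ^ 4 = A ^ 4 := by
      rw [show 4 = 2 * 2 from rfl, pow_mul, pow_mul, pow_two B, pow_two A, hB2]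
    rw [pow_succ, h4, pow_succ A 4]
    ext x y
    simp [B, Matrix.mul_apply]
  -- Projection to one component: the full trace would carry the number of nontrivial components as
  -- a factor, possibly divisible by 5.
  let D : Matrix V V (ZMod 5) := Matrix.diagonal fun x => if x ∈ S then 1 else 0
  have hD : D ^ 5 = D := by
    simp only [D, Matrix.diagonal_pow]
    congr 1
    ext x
    by_cases hx : x ∈ S <;> simp [hx]
  have hBD : Commute B D := by
    ext x y
    simp only [D, Matrix.mul_diagonal, Matrix.diagonal_mul]
    by_cases hxy : G.Adj x (G.opposite y)
    · have : x ∈ S ↔ y ∈ S := by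
        constructor
        · intro hx
          have := h.opposite_mem_of_closed hS (hS hx hxy)
          rwa [h.opposite_involutive] at this
        · exact fun hy => hS (h.opposite_mem_of_closed hS hy) hxy.symm
      simp [this]
    · simp [B, A, σ, hxy]
  have h192 : (32 * 6 : ZMod 5) ≠ 0 := by decide
  have : Fact (Nat.Prime 5) := ⟨by norm_num⟩
  have htr := ZMod.trace_pow_card (p := 5) (B * D)
  rw [hBD.mul_pow, hD, hB5] at htr
  have h1 : (B * D).trace = 0 := by
    simp only [Matrix.trace, Matrix.diag_apply, D, Matrix.mul_diagonal]
    refine Finset.sum_eq_zero fun x _ => ?_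
    simp [B, A, σ, h.not_adj_opposite x]
  have h2 : ((A ^ 5).submatrix id σ * D).trace = 32 * 6 := by
    simp only [Matrix.trace, Matrix.diag_apply, D, Matrix.mul_diagonal, Matrix.submatrix_apply, id,
      mul_ite, mul_one, mul_zero]
    rw [← Finset.sum_filter, Finset.sum_congr rfl (g := fun _ => (6 : ZMod 5)), Finset.sum_const,
      nsmul_eq_mul]
    · congr 1
      have := h.ncard_edgeBall hadj
      rw [← hSdef, Set.ncard_eq_toFinset_card'] at this
      rw [show ({x | x ∈ S} : Finset V) = S.toFinset by ext; simp, this]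
      norm_num
    · intro x hx
      obtain ⟨y, hxy⟩ := hSadj x (by simpa using hx)
      exact h.adjMatrix_pow_five_apply hxy
  rw [h1, h2] at htr
  exact h192 (htr.trans (zero_pow (by norm_num)))

end Matrix

end SimpleGraph

/-! ### Reduction to the local properties -/

theorem mainTheorem2 (v : ℕ) {V : Type*} [Fintype V] (G : SimpleGraph V) [G.LocallyFinite] :
    ¬ G.IsEdgeGirthRegular v 3 8 14 := by
  classical
  intro h
  have hg : G.GirthGEEight := by
    intro w c hc
    have := SimpleGraph.le_egirth.1 h.egirth_eq.ge w c hc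
    exact_mod_cast this
  have hc : G.IsCubic := by
    intro u w huw
    have hcard : (G.neighborFinset u).card = 3 := h.regular u
    have hw : w ∈ G.neighborFinset u := (G.mem_neighborFinset u w).2 huw
    have h2 : ((G.neighborFinset u).erase w).card = 2 := by
      rw [Finset.card_erase_of_mem hw, hcard]
    obtain ⟨a, b, hab, heq⟩ := Finset.card_eq_two.1 h2
    have ha : a ∈ (G.neighborFinset u).erase w := by simp [heq]
    have hb : b ∈ (G.neighborFinset u).erase w := by simp [heq]
    refine ⟨a, b, hab, Finset.ne_of_mem_erase ha, Finset.ne_of_mem_erase hb, fun x => ?_⟩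
    rw [← G.mem_neighborFinset, ← Finset.insert_erase hw, heq]
    simp
  have hs : G.HasTwoStubs := by
    refine ⟨hg, hc, fun u w huw => SimpleGraph.ncard_stubs hg hc huw ?_⟩
    rw [SimpleGraph.ncard_leafEdges hg huw, h.cycles_eq _ huw]
  have hcyc : ¬ G.IsAcyclic := by
    rw [← SimpleGraph.egirth_eq_top, h.egirth_eq]
    exact ENat.natCast_ne_top 8
  -- The local properties hold vacuously without edges; finite girth supplies an edge.
  obtain ⟨u, w, huw⟩ : ∃ u w, G.Adj u w := by
    by_contra hcon
    push Not at hcon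
    refine hcyc fun u c hc => ?_
    cases c with
    | nil => exact hc.not_nil .nil
    | cons h _ => exact hcon _ _ h
  exact hs.not_adj u w huw
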